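/- Let $\mathcal H$ be a real Hilbert space, $L\ge 0$, and let $f:\mathcal H\to\mathbb R$ be convex and differentiable with $L$-Lipschitz continuous gradient and $\operatorname{argmin} f\neq\emptyset$. Let $0<p<2$, $\varepsilon_k=k^{-p}$ for $k\ge 1$, $\delta>0$, and let the step size $s>0$ satisfy $sL<1$. Let $x_0,x_1\in\mathcal H$ be arbitrary and let $(x_k)$ be generated by the Tikhonov regularized inertial gradient algorithm (TRIGA): for $k\ge1$, $$y_k=x_k+\bigl(1-\delta\sqrt{s\varepsilon_k}\bigr)(x_k-x_{k-1}),\qquad x_{k+1}=y_k-s\bigl(\nabla f(y_k)+\varepsilon_k y_k\bigr).$$ Then, for every $k\ge1$, the function $z\mapsto f(z)+\frac{\varepsilon_k}{2}\|z\|^2$ has a unique minimizer $x_{\varepsilon_k}$, the set $\operatorname{argmin} f$ has a unique element $x^*$ of minimal norm, and, as $k\to+\infty$: (i) $f(x_k)-\min_{\mathcal H} f=\mathcal O\bigl(k^{-p}\bigr)$; (ii) $\|x_k-x_{\varepsilon_k}\|^2=\mathcal O\bigl(k^{-(2-p)/2}\bigr)$, and $(x_k)$ converges strongly to $x^*$;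 (iii) $\|x_k-x_{k-1}\|=\mathcal O\bigl(k^{-(2+p)/4}\bigr)$. -/

import Mathlib

open Filter Topology Asymptotics

/-- `x` together with the auxiliary sequence `y` is a run of the Tikhonov regularized inertial
gradient algorithm for `f`, with damping `δ`, step size `s` and Tikhonov parameters `ε`. The
starting points `x 0` and `x 1` are arbitrary, and the updates are made for every `k ≥ 1`. -/
def IsTRIGA {H : Type*} [NormedAddCommGroup H] [InnerProductSpace ℝ H] [CompleteSpace H]
    (f : H → ℝ) (δ s : ℝ) (ε : ℕ → ℝ) (x y : ℕ → H) : Prop :=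
  ∀ k : ℕ, 1 ≤ k →
    y k = x k + (1 - δ * √(s * ε k)) • (x k - x (k - 1)) ∧
    x (k + 1) = y k - s • (gradient f (y k) + ε k • y k)

/-- The Tikhonov regularization `z ↦ f z + (ε / 2) ‖z‖ ^ 2` of `f`. -/
noncomputable def tikhonovReg {H : Type*} [NormedAddCommGroup H] (f : H → ℝ) (ε : ℝ) (z : H) : ℝ :=
  f z + ε / 2 * ‖z‖ ^ 2

/-- `z` is a global minimizer of `f`, that is, `z ∈ argmin f`. -/
def IsMinimizer {H : Type*} (f : H → ℝ) (z : H) : Prop :=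
  ∀ w : H, f z ≤ f w

/-- `z` is the one and only global minimizer of `f`. -/
def IsUniqueMinimizer {H : Type*} (f : H → ℝ) (z : H) : Prop :=
  IsMinimizer f z ∧ ∀ w : H, IsMinimizer f w → w = z

/-- `z` is an element of least norm of `argmin f`, and the only one. -/
def IsMinNormMinimizer {H : Type*} [NormedAddCommGroup H] (f : H → ℝ) (z : H) : Prop :=
  IsMinimizer f z ∧ ∀ w : H, IsMinimizer f w → ‖z‖ ≤ ‖w‖ ∧ (‖w‖ = ‖z‖ → w = z)

/-! Put φ_k = f + (ε_k/2)‖·‖², z_k = argmin φ_k, q_k = √(s ε_k), λ = δ/2. The proof follows the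
energy E_k = s(φ_k(x_k) − min φ_k) + ½‖d‖² + λ⟨b, d⟩ + λ²‖b‖², where d = x_k − x_{k−1} and b =
q_k(x_k − z_k).

With ε frozen, φ_k is ε_k-strongly convex and an inertial step with damping 2λq_k multiplies the
energy by at most 1 − c q_k (`energy_step_le`). Replacing ε_k by ε_{k+1} changes q_k by a relative
O(1/k) and moves the bounded path z_k by O(1/k); this costs a factor close to 1 and an additive
O(k^{−(1+p)}) (`trigaEnergy_drift_le`). Since p < 2, 1/k is negligible against q_k ~ k^{−p/2}, so
about half of the contraction survives, and `exists_eventually_le_mul_rpow_neg` gives E_k =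
O(k^{−(1+p/2)}).

The three rates are read off the three nonnegative pieces controlled by E_k: the value gap, the
distance to z_k (by strong convexity), and the velocity. Strong convergence follows since z_k tends
to the least-norm minimizer (`exists_isMinNormMinimizer_tendsto`). -/

theorem tikhonovReg_midpoint_le {H : Type*} [NormedAddCommGroup H] [InnerProductSpace ℝ H]
    {f : H → ℝ} (hc : ConvexOn ℝ Set.univ f) (ε : ℝ) (a b : H) :
    tikhonovReg f ε ((1 / 2 : ℝ) • a + (1 / 2 : ℝ) • b) + ε / 8 * ‖a - b‖ ^ 2
      ≤ (tikhonovReg f ε a + tikhonovReg f ε b) / 2 := by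
  have h := hc.2 (Set.mem_univ a) (Set.mem_univ b) (by norm_num : (0 : ℝ) ≤ 1 / 2)
    (by norm_num : (0 : ℝ) ≤ 1 / 2) (by norm_num)
  simp only [smul_eq_mul] at h
  have h2 : ‖(1 / 2 : ℝ) • a + (1 / 2 : ℝ) • b‖ ^ 2
      = 1 / 4 * ‖a‖ ^ 2 + 1 / 2 * inner ℝ a b + 1 / 4 * ‖b‖ ^ 2 := by
    rw [norm_add_sq_real, norm_smul, norm_smul, real_inner_smul_left, real_inner_smul_right]
    norm_num
    ring
  unfold tikhonovReg
  rw [h2, norm_sub_sq_real]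
  linarith

theorem IsMinimizer.norm_le_of_tikhonovReg {H : Type*} [NormedAddCommGroup H]
    {f : H → ℝ} {ε : ℝ} (hε : 0 < ε) {z w : H}
    (hz : IsMinimizer (tikhonovReg f ε) z) (hw : IsMinimizer f w) : ‖z‖ ≤ ‖w‖ := by
  have h1 := hz w
  have h2 := hw z
  unfold tikhonovReg at h1
  have h3 : ‖z‖ ^ 2 ≤ ‖w‖ ^ 2 := by nlinarith
  exact (sq_le_sq₀ (norm_nonneg _) (norm_nonneg _)).1 h3

/-! ### Strong convexity, descent lemma and the Tikhonov path. -/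

section ConvexAnalysis

variable {H : Type*} [NormedAddCommGroup H] [InnerProductSpace ℝ H] [CompleteSpace H]

theorem hasDerivAt_comp_line {f : H → ℝ} (hf : Differentiable ℝ f) (y v : H) (t : ℝ) :
    HasDerivAt (fun t : ℝ => f (y + t • v)) (inner ℝ (gradient f (y + t • v)) v) t := by
  have h1 := (hf (y + t • v)).hasGradientAt.hasFDerivAt
  have h2 : HasDerivAt (fun t : ℝ => y + t • v) v t := by
    simpa using ((hasDerivAt_id t).smul_const v).const_add y
  exact h1.comp_hasDerivAt t h2

theorem ConvexOn.add_inner_gradient_le {f : H → ℝ} (hc : ConvexOn ℝ Set.univ f)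
    (hf : Differentiable ℝ f) (y z : H) :
    f y + inner ℝ (gradient f y) (z - y) ≤ f z := by
  have hline : ConvexOn ℝ Set.univ (fun t : ℝ => f (y + t • (z - y))) := by
    have := hc.comp_affineMap (AffineMap.lineMap y z : ℝ →ᵃ[ℝ] H)
    simpa [Function.comp_def, AffineMap.lineMap_apply, add_comm] using this
  have h := hline.le_slope_of_hasDerivAt (Set.mem_univ 0) (Set.mem_univ 1) one_pos
    (hasDerivAt_comp_line hf y (z - y) 0)
  simp only [slope_def_field, zero_smul, add_zero, one_smul, add_sub_cancel, sub_zero, div_one] at h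
  linarith

/-- Descent lemma, without integration: along the segment the difference of the two sides has
nonpositive derivative by the Lipschitz bound. -/
theorem le_add_inner_gradient_add_sq {f : H → ℝ} (hf : Differentiable ℝ f) {L : NNReal}
    (hL : LipschitzWith L (gradient f)) (y v : H) :
    f (y + v) ≤ f y + inner ℝ (gradient f y) v + L / 2 * ‖v‖ ^ 2 := by
  have hd : ∀ t : ℝ, HasDerivAt
      (fun t : ℝ => f (y + t • v) - (t * inner ℝ (gradient f y) v + L / 2 * ‖v‖ ^ 2 * t ^ 2))
      (inner ℝ (gradient f (y + t • v)) v
        - (1 * inner ℝ (gradient f y) v + L / 2 * ‖v‖ ^ 2 * (2 * t))) t := by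
    intro t
    refine (hasDerivAt_comp_line hf y v t).sub (((hasDerivAt_id t).mul_const _).add ?_)
    simpa using ((hasDerivAt_pow 2 t).const_mul (L / 2 * ‖v‖ ^ 2 : ℝ))
  have hanti := antitoneOn_of_deriv_nonpos (convex_Icc (0 : ℝ) 1)
    (fun t _ => (hd t).continuousAt.continuousWithinAt)
    (fun t _ => (hd t).differentiableAt.differentiableWithinAt) (fun t ht => by
      rw [interior_Icc] at ht
      rw [(hd t).deriv]
      have h1 : inner ℝ (gradient f (y + t • v) - gradient f y) v ≤ L * (t * ‖v‖) * ‖v‖ := by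
        refine (real_inner_le_norm _ _).trans ?_
        gcongr
        have := hL.dist_le_mul (y + t • v) y
        rwa [dist_eq_norm, dist_eq_norm, add_sub_cancel_left, norm_smul, Real.norm_eq_abs,
          abs_of_pos ht.1] at this
      rw [inner_sub_left] at h1
      nlinarith)
  have h := hanti (Set.left_mem_Icc.2 zero_le_one) (Set.right_mem_Icc.2 zero_le_one) zero_le_one
  simp only [one_smul, zero_smul, add_zero, one_mul, zero_mul, one_pow, mul_one, ne_eq,
    OfNat.ofNat_ne_zero, not_false_eq_true, zero_pow, mul_zero, sub_zero] at h
  linarith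

theorem add_inner_add_sq_le_tikhonovReg {f : H → ℝ} (hc : ConvexOn ℝ Set.univ f)
    (hf : Differentiable ℝ f) (ε : ℝ) (y z : H) :
    tikhonovReg f ε y + inner ℝ (gradient f y + ε • y) (z - y) + ε / 2 * ‖z - y‖ ^ 2
      ≤ tikhonovReg f ε z := by
  have h := hc.add_inner_gradient_le hf y z
  unfold tikhonovReg
  rw [inner_add_left, real_inner_smul_left, norm_sub_sq_real, inner_sub_right y,
    real_inner_self_eq_norm_sq, real_inner_comm z y]
  linarith

theorem tikhonovReg_add_le {f : H → ℝ} (hf : Differentiable ℝ f) {L : NNReal}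
    (hL : LipschitzWith L (gradient f)) (ε : ℝ) (y v : H) :
    tikhonovReg f ε (y + v) ≤
      tikhonovReg f ε y + inner ℝ (gradient f y + ε • y) v + (L + ε) / 2 * ‖v‖ ^ 2 := by
  have h := le_add_inner_gradient_add_sq hf hL y v
  unfold tikhonovReg
  rw [inner_add_left, real_inner_smul_left, norm_add_sq_real]
  linarith

/-- The Tikhonov regularization of a continuous convex function with a minimizer attains its
minimum. -/
theorem exists_isMinimizer_tikhonovReg {f : H → ℝ} (hc : ConvexOn ℝ Set.univ f)
    (hf : Continuous f) (hmin : ∃ z, IsMinimizer f z) {ε : ℝ} (hε : 0 < ε) :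
    ∃ z, IsMinimizer (tikhonovReg f ε) z := by
  obtain ⟨z₀, hz₀⟩ := hmin
  have hbdd : BddBelow (Set.range (tikhonovReg f ε)) := by
    refine ⟨f z₀, ?_⟩
    rintro _ ⟨w, rfl⟩
    have : 0 ≤ ε / 2 * ‖w‖ ^ 2 := by positivity
    have := hz₀ w
    unfold tikhonovReg
    linarith
  have hcont : Continuous (tikhonovReg f ε) := by
    unfold tikhonovReg
    fun_prop
  set m := ⨅ z, tikhonovReg f ε z with hm
  have hle : ∀ z, m ≤ tikhonovReg f ε z := fun z => ciInf_le hbdd z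
  have hex : ∀ n : ℕ, ∃ z, tikhonovReg f ε z < m + 1 / ((n : ℝ) + 1) := fun n =>
    exists_lt_of_ciInf_lt (lt_add_of_pos_right _ Nat.one_div_pos_of_nat)
  choose u hu using hex
  have hlim : Tendsto (fun n : ℕ => 1 / ((n : ℝ) + 1)) atTop (𝓝 0) :=
    tendsto_one_div_add_atTop_nhds_zero_nat
  have hcau : CauchySeq u := by
    refine cauchySeq_of_le_tendsto_0 (fun N : ℕ => √(8 / ε * (1 / ((N : ℝ) + 1)))) ?_ ?_
    · intro i j N hi hj
      rw [dist_eq_norm]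
      refine Real.le_sqrt_of_sq_le ?_
      -- A minimizing sequence is Cauchy: the midpoint value is at least the infimum, so the strong
      -- convexity gap is at most the suboptimality.
      have h1 := tikhonovReg_midpoint_le hc ε (u i) (u j)
      have h2 := hle ((1 / 2 : ℝ) • u i + (1 / 2 : ℝ) • u j)
      have h3 := hu i
      have h4 := hu j
      have h5 : 1 / ((i : ℝ) + 1) ≤ 1 / ((N : ℝ) + 1) := Nat.one_div_le_one_div hi
      have h6 : 1 / ((j : ℝ) + 1) ≤ 1 / ((N : ℝ) + 1) := Nat.one_div_le_one_div hj
      have h7 : ε / 8 * ‖u i - u j‖ ^ 2 ≤ 1 / ((N : ℝ) + 1) := by linarith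
      calc ‖u i - u j‖ ^ 2 = 8 / ε * (ε / 8 * ‖u i - u j‖ ^ 2) := by field_simp
        _ ≤ _ := by gcongr
    · have := (hlim.const_mul (8 / ε)).sqrt
      simpa using this
  obtain ⟨z, hz⟩ := cauchySeq_tendsto_of_complete hcau
  refine ⟨z, fun w => le_trans ?_ (hle w)⟩
  have h1 := (hcont.tendsto z).comp hz
  have h2 : Tendsto (fun n : ℕ => m + 1 / ((n : ℝ) + 1)) atTop (𝓝 m) := by
    simpa using hlim.const_add m
  exact le_of_tendsto_of_tendsto' h1 h2 fun n => (hu n).le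

/-- A gradient step of length 1/(L + ε) would lower the value by ‖g‖²/(2(L + ε)), which is
impossible at a minimizer unless g = 0. -/
theorem IsMinimizer.gradient_add_smul_eq_zero {f : H → ℝ} (hf : Differentiable ℝ f) {L : NNReal}
    (hL : LipschitzWith L (gradient f)) {ε : ℝ} (hε : 0 < ε) {z : H}
    (hz : IsMinimizer (tikhonovReg f ε) z) : gradient f z + ε • z = 0 := by
  set g := gradient f z + ε • z with hg
  have hpos : 0 < (L : ℝ) + ε := by positivity
  have h1 := tikhonovReg_add_le hf hL ε z (-(1 / ((L : ℝ) + ε)) • g)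
  have h2 := hz (z + -(1 / ((L : ℝ) + ε)) • g)
  rw [← hg, real_inner_smul_right, real_inner_self_eq_norm_sq, norm_smul, Real.norm_eq_abs,
    mul_pow, sq_abs] at h1
  have h3 : -(1 / ((L : ℝ) + ε)) * ‖g‖ ^ 2
      + (L + ε) / 2 * ((-(1 / ((L : ℝ) + ε))) ^ 2 * ‖g‖ ^ 2)
      = - (1 / (2 * ((L : ℝ) + ε)) * ‖g‖ ^ 2) := by field_simp; ring
  have h4 : 1 / (2 * ((L : ℝ) + ε)) * ‖g‖ ^ 2 ≤ 0 := by linarith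
  have h5 : 0 < 1 / (2 * ((L : ℝ) + ε)) := by positivity
  have h6 : ‖g‖ ^ 2 ≤ 0 := by nlinarith
  simpa using le_antisymm h6 (sq_nonneg _)

theorem IsMinimizer.add_sq_le_tikhonovReg {f : H → ℝ} (hc : ConvexOn ℝ Set.univ f)
    (hf : Differentiable ℝ f) {L : NNReal}
    (hL : LipschitzWith L (gradient f)) {ε : ℝ} (hε : 0 < ε) {z : H}
    (hz : IsMinimizer (tikhonovReg f ε) z) (w : H) :
    tikhonovReg f ε z + ε / 2 * ‖w - z‖ ^ 2 ≤ tikhonovReg f ε w := by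
  have h := add_inner_add_sq_le_tikhonovReg hc hf ε z w
  rwa [hz.gradient_add_smul_eq_zero hf hL hε, inner_zero_left, add_zero] at h

theorem IsMinimizer.isUniqueMinimizer_tikhonovReg {f : H → ℝ} (hc : ConvexOn ℝ Set.univ f)
    (hf : Differentiable ℝ f) {L : NNReal}
    (hL : LipschitzWith L (gradient f)) {ε : ℝ} (hε : 0 < ε) {z : H}
    (hz : IsMinimizer (tikhonovReg f ε) z) : IsUniqueMinimizer (tikhonovReg f ε) z := by
  refine ⟨hz, fun w hw => ?_⟩
  have h1 := hz.add_sq_le_tikhonovReg hc hf hL hε w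
  have h2 := hw z
  have h3 : ‖w - z‖ ^ 2 ≤ 0 := by nlinarith
  have h4 : w - z = 0 := by simpa using le_antisymm h3 (sq_nonneg _)
  exact sub_eq_zero.1 h4

/-- Comparison of the minimizers of two Tikhonov regularizations of the same function. -/
theorem mul_sq_norm_sub_tikhonov_le {f : H → ℝ} (hc : ConvexOn ℝ Set.univ f)
    (hf : Differentiable ℝ f) {L : NNReal}
    (hL : LipschitzWith L (gradient f)) {ε η : ℝ} (hε : 0 < ε) (hη : 0 < η) {z w : H}
    (hz : IsMinimizer (tikhonovReg f ε) z) (hw : IsMinimizer (tikhonovReg f η) w) :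
    (η + ε) * ‖z - w‖ ^ 2 ≤ (η - ε) * (‖z‖ ^ 2 - ‖w‖ ^ 2) := by
  have h1 := hz.add_sq_le_tikhonovReg hc hf hL hε w
  have h2 := hw.add_sq_le_tikhonovReg hc hf hL hη z
  rw [norm_sub_rev] at h1
  unfold tikhonovReg at h1 h2
  linarith

/-- Factoring the difference of squares lets one power of ‖z − w‖ cancel, so the path is Lipschitz
in the relative change of the parameter. -/
theorem norm_sub_tikhonov_le {f : H → ℝ} (hc : ConvexOn ℝ Set.univ f)
    (hf : Differentiable ℝ f) {L : NNReal}
    (hL : LipschitzWith L (gradient f)) {ε η R : ℝ} (hε : 0 < ε) (hη : ε ≤ η) {z w : H}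
    (hz : IsMinimizer (tikhonovReg f ε) z) (hw : IsMinimizer (tikhonovReg f η) w)
    (hzR : ‖z‖ ≤ R) (hwR : ‖w‖ ≤ R) :
    ‖z - w‖ ≤ 2 * R * ((η - ε) / η) := by
  have hη0 : 0 < η := hε.trans_le hη
  have h := mul_sq_norm_sub_tikhonov_le hc hf hL hε hη0 hz hw
  have h1 : ‖z‖ - ‖w‖ ≤ ‖z - w‖ := norm_sub_norm_le z w
  have hR : 0 ≤ R := (norm_nonneg z).trans hzR
  have h2 : ‖z‖ ^ 2 - ‖w‖ ^ 2 ≤ ‖z - w‖ * (2 * R) := by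
    rw [sq_sub_sq, mul_comm]
    exact mul_le_mul h1 (by linarith) (by positivity) (norm_nonneg _)
  have h3 : η * ‖z - w‖ ^ 2 ≤ (η - ε) * (‖z - w‖ * (2 * R)) := by
    have := mul_le_mul_of_nonneg_left h2 (sub_nonneg.2 hη)
    nlinarith [sq_nonneg ‖z - w‖]
  rcases (norm_nonneg (z - w)).eq_or_lt with h0 | h0
  · rw [← h0]
    have : 0 ≤ η - ε := sub_nonneg.2 hη
    positivity
  · have h4 : η * ‖z - w‖ ≤ (η - ε) * (2 * R) := by
      refine le_of_mul_le_mul_right ?_ h0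
      linarith
    rw [mul_div_assoc', le_div_iff₀ hη0]
    linarith

/-- The Tikhonov path converges strongly to the minimizer of least norm. -/
theorem exists_isMinNormMinimizer_tendsto {f : H → ℝ} (hc : ConvexOn ℝ Set.univ f)
    (hf : Differentiable ℝ f) {L : NNReal}
    (hL : LipschitzWith L (gradient f)) (hmin : ∃ z, IsMinimizer f z) {ε : ℕ → ℝ} {z : ℕ → H}
    (hε : ∀ n, 0 < ε n) (hanti : Antitone ε) (hlim : Tendsto ε atTop (𝓝 0))
    (hz : ∀ n, IsMinimizer (tikhonovReg f (ε n)) (z n)) :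
    ∃ xstar, IsMinNormMinimizer f xstar ∧ Tendsto z atTop (𝓝 xstar) := by
  obtain ⟨z₀, hz₀⟩ := hmin
  -- The squared norms increase along the path and are bounded by that of any minimizer; this
  -- estimate turns their convergence into the Cauchy property.
  have hkey : ∀ m n, m ≤ n → ‖z n - z m‖ ^ 2 ≤ ‖z n‖ ^ 2 - ‖z m‖ ^ 2 := by
    intro m n hmn
    have h := mul_sq_norm_sub_tikhonov_le hc hf hL (hε n) (hε m) (hz n) (hz m)
    have h1 := hε n
    have h2 := hε m
    rcases (hanti hmn).eq_or_lt with h3 | h3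
    · have : ‖z n - z m‖ ^ 2 ≤ 0 := by nlinarith
      have h4 : z n - z m = 0 := by simpa using le_antisymm this (sq_nonneg _)
      rw [sub_eq_zero.1 h4]
      simp
    · have h5 : 0 < ε m - ε n := by linarith
      refine le_of_mul_le_mul_left ?_ h5
      nlinarith [sq_nonneg ‖z n - z m‖]
  have hmono : Monotone fun n => ‖z n‖ ^ 2 := fun m n hmn => by
    have := hkey m n hmn
    have := sq_nonneg ‖z n - z m‖
    simp only
    linarith
  have hnorm : ∀ w, IsMinimizer f w → ∀ n, ‖z n‖ ≤ ‖w‖ := fun w hw n =>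
    (hz n).norm_le_of_tikhonovReg (hε n) hw
  have hbdd : BddAbove (Set.range fun n => ‖z n‖ ^ 2) := by
    refine ⟨‖z₀‖ ^ 2, ?_⟩
    rintro _ ⟨n, rfl⟩
    have := hnorm z₀ hz₀ n
    simp only
    gcongr
  have hconv := tendsto_atTop_ciSup hmono hbdd
  set S := ⨆ n, ‖z n‖ ^ 2
  have hS : ∀ n, ‖z n‖ ^ 2 ≤ S := fun n => le_ciSup hbdd n
  have hcau : CauchySeq z := by
    refine cauchySeq_of_le_tendsto_0' (fun m => √(S - ‖z m‖ ^ 2)) ?_ ?_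
    · intro m n hmn
      rw [dist_eq_norm, norm_sub_rev]
      refine Real.le_sqrt_of_sq_le ?_
      linarith [hkey m n hmn, hS n]
    · have := (hconv.const_sub S).sqrt
      simpa using this
  obtain ⟨xs, hxs⟩ := cauchySeq_tendsto_of_complete hcau
  have hxsmin : IsMinimizer f xs := by
    intro w
    have h1 : Tendsto (fun n => f (z n)) atTop (𝓝 (f xs)) :=
      (hf.continuous.tendsto xs).comp hxs
    have h2 : Tendsto (fun n => tikhonovReg f (ε n) w) atTop (𝓝 (f w)) := by
      unfold tikhonovReg
      simpa using ((hlim.div_const 2).mul_const (‖w‖ ^ 2)).const_add (f w)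
    refine le_of_tendsto_of_tendsto' h1 h2 fun n => le_trans ?_ (hz n w)
    have := hε n
    have : 0 ≤ ε n / 2 * ‖z n‖ ^ 2 := by positivity
    unfold tikhonovReg
    linarith
  have hle : ∀ w, IsMinimizer f w → ‖xs‖ ≤ ‖w‖ := fun w hw =>
    le_of_tendsto' hxs.norm (hnorm w hw)
  refine ⟨xs, ⟨hxsmin, fun w hw => ⟨hle w hw, fun heq => ?_⟩⟩, hxs⟩
  -- Two least-norm minimizers coincide: their midpoint is also a minimizer and would have smaller
  -- norm.
  have hmid : IsMinimizer f ((1 / 2 : ℝ) • xs + (1 / 2 : ℝ) • w) := by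
    intro v
    have h := hc.2 (Set.mem_univ xs) (Set.mem_univ w) (by norm_num : (0 : ℝ) ≤ 1 / 2)
      (by norm_num : (0 : ℝ) ≤ 1 / 2) (by norm_num)
    simp only [smul_eq_mul] at h
    linarith [hxsmin v, hw v]
  have h1 := hle _ hmid
  have h2 : ‖xs‖ ^ 2 ≤ ‖(1 / 2 : ℝ) • xs + (1 / 2 : ℝ) • w‖ ^ 2 := by gcongr
  rw [norm_add_sq_real, norm_smul, norm_smul, real_inner_smul_left, real_inner_smul_right] at h2
  norm_num at h2
  have h3 : ‖w - xs‖ ^ 2 ≤ 0 := by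
    rw [norm_sub_sq_real, real_inner_comm, heq]
    rw [heq] at h2
    nlinarith
  have h4 : w - xs = 0 := by simpa using le_antisymm h3 (sq_nonneg _)
  exact sub_eq_zero.1 h4

end ConvexAnalysis

/-! ### One-step estimates for the quadratic energy. -/

section Energy

variable {H : Type*} [NormedAddCommGroup H] [InnerProductSpace ℝ H]

/-- The quadratic part of the Lyapunov energy, at velocity `d` and rescaled position `b`. -/
noncomputable def energyQuad (lam : ℝ) (d b : H) : ℝ :=
  1 / 2 * ‖d‖ ^ 2 + lam * inner ℝ b d + lam ^ 2 * ‖b‖ ^ 2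

theorem abs_inner_le_half_sq_add_sq (u v : H) : |inner ℝ u v| ≤ (‖u‖ ^ 2 + ‖v‖ ^ 2) / 2 := by
  have := abs_real_inner_le_norm u v
  nlinarith [sq_nonneg (‖u‖ - ‖v‖)]

/-- The energy equals ‖d/2 + λb‖² + ‖d‖²/4; the next bound uses ½‖d + λb‖² + (λ²/2)‖b‖² instead. -/
theorem sq_norm_le_energyQuad (lam : ℝ) (d b : H) : 1 / 4 * ‖d‖ ^ 2 ≤ energyQuad lam d b := by
  have h : 0 ≤ ‖(1 / 2 : ℝ) • d + lam • b‖ ^ 2 := sq_nonneg _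
  rw [norm_add_sq_real, real_inner_smul_left, real_inner_smul_right, norm_smul, norm_smul,
    mul_pow, mul_pow, Real.norm_eq_abs, Real.norm_eq_abs, sq_abs, sq_abs, real_inner_comm] at h
  unfold energyQuad
  linarith

theorem lam_sq_mul_sq_norm_le_energyQuad (lam : ℝ) (d b : H) :
    lam ^ 2 / 2 * ‖b‖ ^ 2 ≤ energyQuad lam d b := by
  have h : 0 ≤ ‖d + lam • b‖ ^ 2 := sq_nonneg _
  rw [norm_add_sq_real, real_inner_smul_right, norm_smul,
    mul_pow, Real.norm_eq_abs, sq_abs, real_inner_comm] at h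
  unfold energyQuad
  linarith

theorem energyQuad_nonneg (lam : ℝ) (d b : H) : 0 ≤ energyQuad lam d b :=
  le_trans (by positivity) (sq_norm_le_energyQuad lam d b)

theorem energyQuad_le {lam : ℝ} (d b : H) :
    energyQuad lam d b ≤ ‖d‖ ^ 2 + 3 / 2 * (lam ^ 2 * ‖b‖ ^ 2) := by
  have h : 0 ≤ ‖d - lam • b‖ ^ 2 := sq_nonneg _
  rw [norm_sub_sq_real, real_inner_smul_right, norm_smul,
    mul_pow, Real.norm_eq_abs, sq_abs, real_inner_comm] at h
  unfold energyQuad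
  linarith

theorem neg_two_mul_inner_le {r κ m : ℝ} (u v : H) (hm : 0 < m) (h : 4 * r ^ 2 ≤ κ * m) :
    -(2 * r) * inner ℝ u v ≤ κ * ‖u‖ ^ 2 + m / 4 * ‖v‖ ^ 2 := by
  have i1 : 0 ≤ ‖(4 / m * r) • u + v‖ ^ 2 := sq_nonneg _
  rw [norm_add_sq_real, real_inner_smul_left, norm_smul, mul_pow, Real.norm_eq_abs, sq_abs] at i1
  have i2 : 4 / m * r ^ 2 ≤ κ := by
    rwa [div_mul_eq_mul_div, div_le_iff₀ hm]
  have i3 := mul_le_mul_of_nonneg_left i1 (by positivity : 0 ≤ m / 4)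
  have i4 : m / 4 * ((4 / m * r) ^ 2 * ‖u‖ ^ 2 + 2 * (4 / m * r * inner ℝ u v) + ‖v‖ ^ 2)
      = 4 / m * r ^ 2 * ‖u‖ ^ 2 + 2 * r * inner ℝ u v + m / 4 * ‖v‖ ^ 2 := by
    field_simp
  have i5 := mul_le_mul_of_nonneg_right i2 (sq_nonneg ‖u‖)
  rw [i4] at i3
  linarith

/-- One step of the inertial method with frozen regularization contracts the energy. -/
theorem energy_step_le {lam q m c F F' : ℝ} {a d G : H} (hlam : 0 < lam) (hq : 0 < q) (hm : 0 < m)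
    (hc : 0 < c) (hF : 0 ≤ F) (h1q : lam * q ≤ 1 / 2) (h2q : q * (4 * lam ^ 2 + 1) ≤ 1 / 4)
    (h3q : 72 * (lam * q) ≤ m) (h4q : 32 * (lam ^ 3 * q) ≤ m) (hc1 : c ≤ lam / 4)
    (hc2 : 12 * (lam * c) ≤ 1)
    (h1 : F' ≤ F + (1 - 2 * lam * q) * inner ℝ G d - (1 / 2 + m) * ‖G‖ ^ 2)
    (h2 : F' ≤ inner ℝ G (a + (1 - 2 * lam * q) • d)
      - q ^ 2 / 2 * ‖a + (1 - 2 * lam * q) • d‖ ^ 2 - (1 / 2 + m) * ‖G‖ ^ 2) :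
    F' + energyQuad lam ((1 - 2 * lam * q) • d - G) (q • (a + ((1 - 2 * lam * q) • d - G)))
      ≤ (1 - c * q) * (F + energyQuad lam d (q • a)) := by
  have hα0 : 0 ≤ 1 - 2 * lam * q := by linarith
  have hα1 : 1 - 2 * lam * q ≤ 1 := by linarith [mul_pos hlam hq]
  set α := 1 - 2 * lam * q with hα
  set b := q • a with hb
  have hD : 0 ≤ ‖d‖ ^ 2 := sq_nonneg _
  have hN : 0 ≤ ‖G‖ ^ 2 := sq_nonneg _
  have hB : 0 ≤ ‖b‖ ^ 2 := sq_nonneg _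
  have hX := abs_inner_le_half_sq_add_sq b d
  -- the second inequality, in terms of the rescaled position
  have h2' : q * F' ≤ inner ℝ b G + q * α * inner ℝ d G
      - q / 2 * (‖b‖ ^ 2 + 2 * q * α * inner ℝ b d + q ^ 2 * α ^ 2 * ‖d‖ ^ 2)
      - q * (1 / 2 + m) * ‖G‖ ^ 2 := by
    have e1 : q * inner ℝ G (a + α • d) = inner ℝ b G + q * α * inner ℝ d G := by
      rw [inner_add_right, real_inner_smul_right, hb, real_inner_smul_left, real_inner_comm a,
        real_inner_comm d]
      ring
    have e2 : q ^ 2 * ‖a + α • d‖ ^ 2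
        = ‖b‖ ^ 2 + 2 * q * α * inner ℝ b d + q ^ 2 * α ^ 2 * ‖d‖ ^ 2 := by
      rw [norm_add_sq_real, real_inner_smul_right, hb, norm_smul, norm_smul, real_inner_smul_left,
        mul_pow, mul_pow, Real.norm_eq_abs, Real.norm_eq_abs, sq_abs, sq_abs]
      ring
    have := mul_le_mul_of_nonneg_left h2 hq.le
    linear_combination this + e1 - q / 2 * e2
  have e3 : energyQuad lam (α • d - G) (q • (a + (α • d - G)))
      = (1 / 2 + lam * q + lam ^ 2 * q ^ 2) *
          (α ^ 2 * ‖d‖ ^ 2 - 2 * α * inner ℝ d G + ‖G‖ ^ 2)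
        + (lam + 2 * lam ^ 2 * q) * (α * inner ℝ b d - inner ℝ b G) + lam ^ 2 * ‖b‖ ^ 2 := by
    have e4 : ‖α • d - G‖ ^ 2 = α ^ 2 * ‖d‖ ^ 2 - 2 * α * inner ℝ d G + ‖G‖ ^ 2 := by
      rw [norm_sub_sq_real, real_inner_smul_left, norm_smul, mul_pow, Real.norm_eq_abs, sq_abs]
      ring
    have e5 : inner ℝ b (α • d - G) = α * inner ℝ b d - inner ℝ b G := by
      rw [inner_sub_right, real_inner_smul_right]
    unfold energyQuad
    rw [smul_add, ← hb, inner_add_left, real_inner_smul_left (α • d - G),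
      real_inner_self_eq_norm_sq, norm_add_sq_real, real_inner_smul_right, norm_smul q (α • d - G), mul_pow, Real.norm_eq_abs,
      sq_abs, e4, e5]
    ring
  have h1' : F' ≤ F + α * inner ℝ d G - (1 / 2 + m) * ‖G‖ ^ 2 := by
    rwa [real_inner_comm d] at h1
  -- Convex combination of the two hypotheses with weights 1 − λq and λq: the leading terms in ⟨b,
  -- G⟩, ⟨d, G⟩ and ‖G‖² then cancel those of the quadratic part.
  have hF' : F' ≤ (1 - lam * q) * F + α * inner ℝ d G + lam * inner ℝ b G
      - lam * q / 2 * (‖b‖ ^ 2 + 2 * q * α * inner ℝ b d + q ^ 2 * α ^ 2 * ‖d‖ ^ 2)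
      - (1 / 2 + m) * ‖G‖ ^ 2 := by
    have i1 := mul_le_mul_of_nonneg_left h1' (by linarith : 0 ≤ 1 - lam * q)
    have i2 := mul_le_mul_of_nonneg_left h2' hlam.le
    linear_combination i1 + i2
  have hlq : 0 < lam * q := by positivity
  -- bounds for the error terms
  have bX : -(q ^ 2 * lam * (4 * lam ^ 2 + α)) * inner ℝ b d
      ≤ lam * q / 8 * (‖d‖ ^ 2 + ‖b‖ ^ 2) := by
    have i1 : q * (4 * lam ^ 2 + α) ≤ 1 / 4 := le_trans (by gcongr) h2q
    have i0 : 0 ≤ q * (4 * lam ^ 2 + α) := by positivity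
    have i2 : -(q * (4 * lam ^ 2 + α)) * inner ℝ b d ≤ 1 / 4 * ((‖b‖ ^ 2 + ‖d‖ ^ 2) / 2) := by
      calc -(q * (4 * lam ^ 2 + α)) * inner ℝ b d
          = (q * (4 * lam ^ 2 + α)) * (-inner ℝ b d) := by ring
        _ ≤ (q * (4 * lam ^ 2 + α)) * |inner ℝ b d| := by
            gcongr
            exact neg_le_abs _
        _ ≤ _ := by gcongr
    have := mul_le_mul_of_nonneg_left i2 hlq.le
    linear_combination this
  have bZ : -(2 * α * (lam * q + lam ^ 2 * q ^ 2)) * inner ℝ d G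
      ≤ lam * q / 8 * ‖d‖ ^ 2 + m / 4 * ‖G‖ ^ 2 := by
    have hr0 : 0 ≤ α * (lam * q + lam ^ 2 * q ^ 2) := by positivity
    have hr1 : α * (lam * q + lam ^ 2 * q ^ 2) ≤ 3 / 2 * (lam * q) := by
      have i1 : lam * q * (lam * q) ≤ lam * q * (1 / 2) := by gcongr
      calc α * (lam * q + lam ^ 2 * q ^ 2) ≤ 1 * (lam * q + lam ^ 2 * q ^ 2) := by gcongr
        _ ≤ _ := by linarith
    have hr2 : (α * (lam * q + lam ^ 2 * q ^ 2)) ^ 2 ≤ (3 / 2 * (lam * q)) ^ 2 := by gcongr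
    have i2 : lam * q * (72 * (lam * q)) ≤ lam * q * m := by gcongr
    have := neg_two_mul_inner_le (r := α * (lam * q + lam ^ 2 * q ^ 2)) (κ := lam * q / 8)
      d G hm (by linarith)
    linarith
  have bY : -(2 * lam ^ 2 * q) * inner ℝ b G ≤ lam * q / 8 * ‖b‖ ^ 2 + m / 4 * ‖G‖ ^ 2 := by
    have i2 : lam * q * (32 * (lam ^ 3 * q)) ≤ lam * q * m := by gcongr
    have := neg_two_mul_inner_le (r := lam ^ 2 * q) (κ := lam * q / 8) b G hm (by linarith)
    linarith
  have bN : (lam * q + lam ^ 2 * q ^ 2 - m) * ‖G‖ ^ 2 ≤ -(m / 2) * ‖G‖ ^ 2 := by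
    refine mul_le_mul_of_nonneg_right ?_ hN
    have i1 : lam * q * (lam * q) ≤ lam * q * (1 / 2) := by gcongr
    linarith
  have bD : (α ^ 2 * (1 / 2 + lam * q + lam ^ 2 * q ^ 2) - lam * q / 2 * (q ^ 2 * α ^ 2))
      * ‖d‖ ^ 2 ≤ (1 / 2 - lam * q) * ‖d‖ ^ 2 := by
    refine mul_le_mul_of_nonneg_right ?_ hD
    have i1 : (lam * q) ^ 2 ≤ (1 / 2) ^ 2 := by gcongr
    have i2 : 0 ≤ lam * q / 2 * (q ^ 2 * α ^ 2) := by positivity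
    have i3 : 4 * ((lam * q) ^ 2 * (lam * q) ^ 2) ≤ (lam * q) ^ 2 := by
      have := mul_le_mul_of_nonneg_left i1 (sq_nonneg (lam * q))
      linarith
    have i4 : α ^ 2 * (1 / 2 + lam * q + lam ^ 2 * q ^ 2)
        = 1 / 2 - lam * q - (lam * q) ^ 2 + 4 * ((lam * q) ^ 2 * (lam * q) ^ 2) := by
      rw [hα]
      ring
    linarith
  -- The error terms take λq/8 twice from each of ‖d‖² and ‖b‖², whose initial gains are λq and
  -- λq/2; the ‖G‖² errors, m/4 twice, are absorbed by −m/2.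
  have hE : F' + energyQuad lam (α • d - G) (q • (a + (α • d - G)))
      ≤ F + energyQuad lam d b
        - lam * q * (F + 3 / 4 * ‖d‖ ^ 2 + 1 / 4 * ‖b‖ ^ 2) := by
    -- Damping exactly 2λq removes the first-order term in q from the coefficient of ⟨b, d⟩.
    have e6 : lam * α + 2 * lam ^ 2 * q * α - lam * q ^ 2 * α
        = lam - q ^ 2 * lam * (4 * lam ^ 2 + α) := by
      rw [hα]
      ring
    rw [e3]
    unfold energyQuad
    linear_combination hF' + bX + bZ + bY + bN + bD + inner ℝ b d * e6
  have hE0 : c * q * (F + energyQuad lam d b)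
      ≤ lam * q * (F + 3 / 4 * ‖d‖ ^ 2 + 1 / 4 * ‖b‖ ^ 2) := by
    have i1 := energyQuad_le (lam := lam) d b
    have i2 : c * (F + energyQuad lam d b)
        ≤ lam * (F + 3 / 4 * ‖d‖ ^ 2 + 1 / 4 * ‖b‖ ^ 2) := by
      have j1 : c * F ≤ lam * F := by gcongr; linarith
      have j2 : c * ‖d‖ ^ 2 ≤ lam * (3 / 4) * ‖d‖ ^ 2 := by gcongr; linarith
      have j3 : c * (3 / 2 * lam ^ 2) * ‖b‖ ^ 2 ≤ lam * (1 / 4) * ‖b‖ ^ 2 := by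
        gcongr ?_ * _
        have := mul_le_mul_of_nonneg_left hc2 hlam.le
        linarith
      have j4 := mul_le_mul_of_nonneg_left i1 hc.le
      linarith
    have := mul_le_mul_of_nonneg_left i2 hq.le
    linarith
  linarith

/-- Effect on the energy of a perturbation of the position. -/
theorem energyQuad_add_le {lam ρ t ζ : ℝ} {d b e : H} (hlam : 0 < lam) (hρ0 : 0 ≤ ρ) (hρ1 : ρ ≤ 1)
    (ht : 0 ≤ t) (hζ : 0 < ζ) (he : ‖e‖ ≤ ρ * ‖b‖ + t) :
    energyQuad lam d (b + e) ≤ (1 + 11 * ρ + 12 * ζ) * energyQuad lam d b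
      + (2 + 1 / (2 * ζ)) * (lam * t) ^ 2 := by
  have hu := sq_norm_le_energyQuad lam d b
  have hw := lam_sq_mul_sq_norm_le_energyQuad lam d b
  set Q := energyQuad lam d b with hQ
  have hu0 : 0 ≤ ‖d‖ := norm_nonneg _
  have hw0 : 0 ≤ lam * ‖b‖ := by positivity
  have he0 : 0 ≤ lam * ‖e‖ := by positivity
  have ht0 : 0 ≤ lam * t := by positivity
  have he' : lam * ‖e‖ ≤ ρ * (lam * ‖b‖) + lam * t := by
    have := mul_le_mul_of_nonneg_left he hlam.le
    linarith
  have hexp : energyQuad lam d (b + e)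
      = Q + lam * inner ℝ e d + 2 * lam ^ 2 * inner ℝ b e + lam ^ 2 * ‖e‖ ^ 2 := by
    rw [hQ]
    unfold energyQuad
    rw [inner_add_left, norm_add_sq_real]
    ring
  have h1 : lam * inner ℝ e d ≤ lam * ‖e‖ * ‖d‖ := by
    rw [mul_assoc]
    gcongr
    exact real_inner_le_norm _ _
  have h2 : 2 * lam ^ 2 * inner ℝ b e ≤ 2 * (lam * ‖b‖) * (lam * ‖e‖) := by
    have := mul_le_mul_of_nonneg_left (real_inner_le_norm b e) (by positivity : 0 ≤ 2 * lam ^ 2)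
    linarith
  rw [hexp]
  generalize ‖d‖ = u at *
  have hw' : (lam * ‖b‖) ^ 2 ≤ 2 * Q := by linarith
  have h3 : lam ^ 2 * ‖e‖ ^ 2 = (lam * ‖e‖) ^ 2 := by ring
  rw [h3]
  generalize lam * ‖b‖ = w at *
  generalize lam * ‖e‖ = v at *
  generalize lam * t = τ at *
  -- From u² ≤ 4Q and w² ≤ 2Q: uw + 2w² ≤ 7Q, and 7 + 4 gives the constant 11; (u + 2w)² ≤ 24Q gives
  -- the 12.
  have h4 : (u + 2 * w) * v ≤ (u + 2 * w) * (ρ * w + τ) := by gcongr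
  have h5 : v ^ 2 ≤ 2 * ρ ^ 2 * w ^ 2 + 2 * τ ^ 2 := by
    have : v ^ 2 ≤ (ρ * w + τ) ^ 2 := by gcongr
    nlinarith [sq_nonneg (ρ * w - τ)]
  have h6 : ρ * (u * w + 2 * w ^ 2) ≤ ρ * (7 * Q) := by
    gcongr
    nlinarith [sq_nonneg (u - w)]
  have h7 : 2 * ρ ^ 2 * w ^ 2 ≤ ρ * (4 * Q) := by
    have i1 : ρ ^ 2 ≤ ρ := by nlinarith
    have i2 : ρ ^ 2 * w ^ 2 ≤ ρ * (2 * Q) := by gcongr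
    linarith
  have h8 : (u + 2 * w) * τ ≤ 12 * ζ * Q + 1 / (2 * ζ) * τ ^ 2 := by
    have i1 : 0 ≤ 1 / (2 * ζ) * (ζ * (u + 2 * w) - τ) ^ 2 := by positivity
    have i2 : 1 / (2 * ζ) * (ζ * (u + 2 * w) - τ) ^ 2
        = ζ / 2 * (u + 2 * w) ^ 2 - (u + 2 * w) * τ + 1 / (2 * ζ) * τ ^ 2 := by
      field_simp
      ring
    have i3 : ζ / 2 * (u + 2 * w) ^ 2 ≤ ζ / 2 * (24 * Q) := by
      gcongr
      nlinarith [sq_nonneg (u - 2 * w)]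
    linarith
  linarith

end Energy

/-! ### Decay of perturbed contractions. -/

section Recursion

/-- Both sides compare with the exponential: 1 − b/t ≤ e^{−b/t} ≤ (1 + 1/t)^{−b}. -/
theorem rpow_neg_mul_one_sub_le {b t : ℝ} (hb : 0 ≤ b) (ht : 0 < t) :
    t ^ (-b) * (1 - b / t) ≤ (t + 1) ^ (-b) := by
  have h1 : t + 1 = t * (1 + 1 / t) := by field_simp
  have h2 : 0 < 1 + 1 / t := by positivity
  rw [h1, Real.mul_rpow ht.le h2.le]
  refine mul_le_mul_of_nonneg_left ?_ (by positivity)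
  have h3 : 1 + 1 / t ≤ Real.exp (1 / t) := by
    linarith [Real.add_one_le_exp (1 / t)]
  calc 1 - b / t ≤ Real.exp (1 / t * -b) := by
        have := Real.add_one_le_exp (1 / t * -b)
        have e : 1 / t * -b = -(b / t) := by ring
        rw [e] at this ⊢
        linarith
    _ = Real.exp (1 / t) ^ (-b) := by rw [Real.exp_mul]
    _ ≤ (1 + 1 / t) ^ (-b) := Real.rpow_le_rpow_of_nonpos h2 h3 (by linarith)

theorem tendsto_natCast_rpow_neg {θ : ℝ} (hθ : 0 < θ) :
    Tendsto (fun k : ℕ => (k : ℝ) ^ (-θ)) atTop (𝓝 0) :=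
  (tendsto_rpow_neg_atTop hθ).comp tendsto_natCast_atTop_atTop

theorem eventually_inv_le_mul_rpow_neg {θ η : ℝ} (hθ : θ < 1) (hη : 0 < η) :
    ∀ᶠ k : ℕ in atTop, 1 / (k : ℝ) ≤ η * (k : ℝ) ^ (-θ) := by
  filter_upwards [(tendsto_natCast_rpow_neg (sub_pos.2 hθ)).eventually_le_const hη,
    eventually_gt_atTop 0] with k hk hk0
  have hk1 : (0 : ℝ) < k := by exact_mod_cast hk0
  have h : 1 / (k : ℝ) = (k : ℝ) ^ (-(1 - θ)) * (k : ℝ) ^ (-θ) := by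
    rw [← Real.rpow_add hk1, one_div, ← Real.rpow_neg_one]
    congr 1
    ring
  rw [h]
  gcongr

/-- A perturbed contraction with contraction factor `1 - c k ^ (-θ)`, `θ < 1`, and perturbation
`C k ^ (-(b + θ))` decays like `k ^ (-b)`. -/
theorem exists_eventually_le_mul_rpow_neg {e : ℕ → ℝ} {θ b c C : ℝ} (hθ0 : 0 < θ) (hθ1 : θ < 1)
    (hb : 0 ≤ b) (hc : 0 < c) (hC : 0 ≤ C)
    (he : ∀ᶠ k : ℕ in atTop,
      e (k + 1) ≤ (1 - c * (k : ℝ) ^ (-θ)) * e k + C * (k : ℝ) ^ (-(b + θ))) :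
    ∃ M : ℝ, 0 ≤ M ∧ ∀ᶠ k : ℕ in atTop, e k ≤ M * (k : ℝ) ^ (-b) := by
  have h1 : ∀ᶠ k : ℕ in atTop, (k : ℝ) ^ (-θ) ≤ 1 / c :=
    (tendsto_natCast_rpow_neg hθ0).eventually_le_const (by positivity)
  have h2 := eventually_inv_le_mul_rpow_neg (η := c / (2 * (b + 1))) hθ1 (by positivity)
  obtain ⟨K, hK⟩ := eventually_atTop.1 (he.and (h1.and (h2.and (eventually_gt_atTop 0))))
  have hK0 : (0 : ℝ) < K := by exact_mod_cast (hK K le_rfl).2.2.2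
  -- The first entry lets half of the contraction absorb the perturbation, the other half paying for
  -- k^{−b} → (k+1)^{−b}; the second entry starts the induction.
  refine ⟨max (2 * C / c) (|e K| * (K : ℝ) ^ b), by positivity, ?_⟩
  set M := max (2 * C / c) (|e K| * (K : ℝ) ^ b) with hM
  have hM0 : 0 ≤ M := by positivity
  have hMC : C ≤ c / 2 * M := by
    have : 2 * C / c ≤ M := le_max_left _ _
    rw [div_le_iff₀ hc] at this
    linarith
  refine eventually_atTop.2 ⟨K, fun k hk => ?_⟩
  induction k, hk using Nat.le_induction with
  | base =>
    calc e K ≤ |e K| := le_abs_self _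
      _ = |e K| * (K : ℝ) ^ b * (K : ℝ) ^ (-b) := by
          rw [mul_assoc, ← Real.rpow_add hK0]
          simp
      _ ≤ M * (K : ℝ) ^ (-b) := by
          gcongr
          exact le_max_right _ _
  | succ k hk ih =>
    obtain ⟨g1, g2, g3, g4⟩ := hK k hk
    have hk0 : (0 : ℝ) < k := by exact_mod_cast g4
    have j1 : 0 ≤ 1 - c * (k : ℝ) ^ (-θ) := by
      rw [le_div_iff₀ hc] at g2
      linarith
    have j2 : (k : ℝ) ^ (-(b + θ)) = (k : ℝ) ^ (-θ) * (k : ℝ) ^ (-b) := by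
      rw [← Real.rpow_add hk0]
      congr 1
      ring
    have j3 : b / (k : ℝ) ≤ c / 2 * (k : ℝ) ^ (-θ) := by
      calc b / (k : ℝ) ≤ (b + 1) * (1 / k) := by
            rw [mul_one_div]
            gcongr
            linarith
        _ ≤ (b + 1) * (c / (2 * (b + 1)) * (k : ℝ) ^ (-θ)) := by gcongr
        _ = c / 2 * (k : ℝ) ^ (-θ) := by field_simp
    have j4 := rpow_neg_mul_one_sub_le hb hk0
    have j5 : (0 : ℝ) < (k : ℝ) ^ (-b) := by positivity
    have j6 : (0 : ℝ) < (k : ℝ) ^ (-θ) := by positivity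
    push_cast
    calc e (k + 1) ≤ (1 - c * (k : ℝ) ^ (-θ)) * (M * (k : ℝ) ^ (-b))
          + C * ((k : ℝ) ^ (-θ) * (k : ℝ) ^ (-b)) := by
            rw [← j2]
            exact g1.trans (by gcongr)
      _ ≤ (1 - c * (k : ℝ) ^ (-θ)) * (M * (k : ℝ) ^ (-b))
          + c / 2 * M * ((k : ℝ) ^ (-θ) * (k : ℝ) ^ (-b)) := by gcongr
      _ = M * ((k : ℝ) ^ (-b) * (1 - c / 2 * (k : ℝ) ^ (-θ))) := by ring
      _ ≤ M * ((k : ℝ) ^ (-b) * (1 - b / (k : ℝ))) := by gcongr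
      _ ≤ M * ((k : ℝ) + 1) ^ (-b) := by gcongr

end Recursion

/-! ### Energy of the algorithm: contraction and drift. -/

section Algorithm

variable {H : Type*} [NormedAddCommGroup H] [InnerProductSpace ℝ H] [CompleteSpace H]

/-- Descent lemma from y to the new point, plus strong convexity between y and w. It is used with w
the current iterate and w the regularized minimizer. -/
theorem tikhonovReg_gradient_step_le {f : H → ℝ} (hc : ConvexOn ℝ Set.univ f)
    (hf : Differentiable ℝ f) {L : NNReal} (hL : LipschitzWith L (gradient f)) {ε s m : ℝ}
    (hs : 0 < s) (hm : s * (L + ε) ≤ 1 - 2 * m) (y w : H) :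
    s * tikhonovReg f ε (y - s • (gradient f y + ε • y)) ≤ s * tikhonovReg f ε w
      + inner ℝ (s • (gradient f y + ε • y)) (y - w) - s * ε / 2 * ‖y - w‖ ^ 2
      - (1 / 2 + m) * ‖s • (gradient f y + ε • y)‖ ^ 2 := by
  set g := gradient f y + ε • y with hg
  have h1 := tikhonovReg_add_le hf hL ε y (-(s • g))
  have h2 := add_inner_add_sq_le_tikhonovReg hc hf ε y w
  rw [← hg, ← sub_eq_add_neg, inner_neg_right, real_inner_smul_right, real_inner_self_eq_norm_sq,
    norm_neg, norm_smul, mul_pow, Real.norm_eq_abs, sq_abs] at h1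
  rw [← hg, norm_sub_rev, ← neg_sub y w, inner_neg_right] at h2
  rw [real_inner_smul_left, norm_smul, mul_pow, Real.norm_eq_abs, sq_abs]
  have h3 := mul_le_mul_of_nonneg_left (h1.trans (add_le_add_left (add_le_add_left
    (by linarith : tikhonovReg f ε y ≤ tikhonovReg f ε w + inner ℝ g (y - w)
      - ε / 2 * ‖y - w‖ ^ 2) _) _)) hs.le
  have h4 := mul_le_mul_of_nonneg_right hm (by positivity : 0 ≤ s ^ 2 * ‖g‖ ^ 2 / 2)
  linarith

/-- The Lyapunov energy of the algorithm. -/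
noncomputable def trigaEnergy (f : H → ℝ) (s lam ε : ℝ) (z u d : H) : ℝ :=
  s * (tikhonovReg f ε u - tikhonovReg f ε z) + energyQuad lam d (√(s * ε) • (u - z))

theorem trigaEnergy_step_le {f : H → ℝ} (hconv : ConvexOn ℝ Set.univ f)
    (hf : Differentiable ℝ f) {L : NNReal} (hL : LipschitzWith L (gradient f)) {ε s m c lam : ℝ}
    (hε : 0 < ε) (hs : 0 < s) (hm0 : 0 < m) (hm : s * (L + ε) ≤ 1 - 2 * m) (hlam : 0 < lam)
    (hc : 0 < c) (hc1 : c ≤ lam / 4) (hc2 : 12 * (lam * c) ≤ 1)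
    (h1q : lam * √(s * ε) ≤ 1 / 2) (h2q : √(s * ε) * (4 * lam ^ 2 + 1) ≤ 1 / 4)
    (h3q : 72 * (lam * √(s * ε)) ≤ m) (h4q : 32 * (lam ^ 3 * √(s * ε)) ≤ m)
    {z u v y w : H} (hz : IsMinimizer (tikhonovReg f ε) z)
    (hy : y = u + (1 - 2 * lam * √(s * ε)) • (u - v))
    (hw : w = y - s • (gradient f y + ε • y)) :
    trigaEnergy f s lam ε z w (w - u)
      ≤ (1 - c * √(s * ε)) * trigaEnergy f s lam ε z u (u - v) := by
  have hq2 : √(s * ε) ^ 2 = s * ε := Real.sq_sqrt (by positivity)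
  have hq : 0 < √(s * ε) := Real.sqrt_pos.2 (by positivity)
  set q := √(s * ε) with hqdef
  have i1 := tikhonovReg_gradient_step_le hconv hf hL hs hm y u
  have i2 := tikhonovReg_gradient_step_le hconv hf hL hs hm y z
  rw [← hw] at i1 i2
  set G := s • (gradient f y + ε • y) with hG
  have e1 : y - u = (1 - 2 * lam * q) • (u - v) := by rw [hy]; abel
  have e2 : y - z = u - z + (1 - 2 * lam * q) • (u - v) := by rw [hy]; abel
  have e3 : w - u = (1 - 2 * lam * q) • (u - v) - G := by rw [hw, ← e1]; abel
  have e4 : w - z = u - z + ((1 - 2 * lam * q) • (u - v) - G) := by rw [← e3]; abel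
  have hF : 0 ≤ s * (tikhonovReg f ε u - tikhonovReg f ε z) :=
    mul_nonneg hs.le (sub_nonneg.2 (hz u))
  unfold trigaEnergy
  rw [← hqdef, e3, e4]
  refine energy_step_le hlam hq hm0 hc hF h1q h2q h3q h4q hc1 hc2 ?_ ?_
  · rw [e1, real_inner_smul_right] at i1
    have : 0 ≤ s * ε / 2 * ‖(1 - 2 * lam * q) • (u - v)‖ ^ 2 := by positivity
    linarith
  · rw [e2, ← hq2] at i2
    linarith

/-- Lowering ε does not increase the value at w and lowers the minimum by at most (ε − ε')R²/2. In
the quadratic part the rescaled position moves by (q' − q)(w − z) + q'(z − z'). -/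
theorem trigaEnergy_drift_le {f : H → ℝ} (hconv : ConvexOn ℝ Set.univ f)
    (hf : Differentiable ℝ f) {L : NNReal} (hL : LipschitzWith L (gradient f))
    {ε ε' s lam ρ ζ R : ℝ} (hε' : 0 < ε') (hle : ε' ≤ ε) (hs : 0 < s) (hlam : 0 < lam)
    (hρ0 : 0 ≤ ρ) (hρ1 : ρ ≤ 1) (hζ : 0 < ζ) {z z' w d : H}
    (hρε : (ε - ε') / ε ≤ 2 * ρ) (hρq : √(s * ε) - √(s * ε') ≤ ρ * √(s * ε))
    (hz : IsMinimizer (tikhonovReg f ε) z) (hz' : IsMinimizer (tikhonovReg f ε') z')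
    (hzR : ‖z‖ ≤ R) (hzR' : ‖z'‖ ≤ R) :
    trigaEnergy f s lam ε' z' w d ≤ (1 + 11 * ρ + 12 * ζ) * trigaEnergy f s lam ε z w d
      + s * (ε - ε') / 2 * R ^ 2
      + (2 + 1 / (2 * ζ)) * (lam * (4 * R * ρ * √(s * ε))) ^ 2 := by
  have hR : 0 ≤ R := (norm_nonneg z).trans hzR
  have hqq : √(s * ε') ≤ √(s * ε) := Real.sqrt_le_sqrt (by gcongr)
  have hq0 : 0 ≤ √(s * ε) := Real.sqrt_nonneg _
  have hq0' : 0 ≤ √(s * ε') := Real.sqrt_nonneg _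
  unfold trigaEnergy
  set q := √(s * ε)
  set q' := √(s * ε')
  have hD : ‖z - z'‖ ≤ 2 * R * (2 * ρ) := by
    rw [norm_sub_rev]
    exact (norm_sub_tikhonov_le hconv hf hL hε' hle hz' hz hzR' hzR).trans (by gcongr)
  have he : q' • (w - z') = q • (w - z) + ((q' - q) • (w - z) + q' • (z - z')) := by module
  have hen : ‖(q' - q) • (w - z) + q' • (z - z')‖ ≤ ρ * ‖q • (w - z)‖ + 4 * R * ρ * q := by
    refine (norm_add_le _ _).trans (add_le_add ?_ ?_)
    · rw [norm_smul, norm_smul, Real.norm_eq_abs, Real.norm_eq_abs, abs_of_nonneg hq0, abs_sub_comm,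
        abs_of_nonneg (sub_nonneg.2 hqq), ← mul_assoc]
      gcongr
    · rw [norm_smul, Real.norm_eq_abs, abs_of_nonneg hq0']
      calc q' * ‖z - z'‖ ≤ q * (2 * R * (2 * ρ)) := by gcongr
        _ = _ := by ring
  have hQ := energyQuad_add_le (d := d) hlam hρ0 hρ1 (by positivity : 0 ≤ 4 * R * ρ * q) hζ hen
  rw [← he] at hQ
  have hF : s * (tikhonovReg f ε' w - tikhonovReg f ε' z')
      ≤ s * (tikhonovReg f ε w - tikhonovReg f ε z) + s * (ε - ε') / 2 * R ^ 2 := by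
    have i1 := hz z'
    have i2 : ‖z'‖ ^ 2 ≤ R ^ 2 := by gcongr
    have i3 := mul_le_mul_of_nonneg_left i2 (sub_nonneg.2 hle)
    have i4 := mul_nonneg (sub_nonneg.2 hle) (sq_nonneg ‖w‖)
    have i5 : tikhonovReg f ε' w - tikhonovReg f ε' z'
        ≤ tikhonovReg f ε w - tikhonovReg f ε z + (ε - ε') / 2 * R ^ 2 := by
      unfold tikhonovReg at i1 ⊢
      linarith
    have := mul_le_mul_of_nonneg_left i5 hs.le
    linarith
  have hF0 : 0 ≤ (11 * ρ + 12 * ζ) * (s * (tikhonovReg f ε w - tikhonovReg f ε z)) :=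
    mul_nonneg (by positivity) (mul_nonneg hs.le (sub_nonneg.2 (hz w)))
  linarith

end Algorithm

theorem mul_le_one_add_mul_of_contraction {t σ E E' : ℝ} (ht : 0 ≤ t) (ht1 : t ≤ 1) (hσ : 0 ≤ σ)
    (hσt : σ ≤ t / 2) (hE : 0 ≤ E) (h : E' ≤ (1 - t) * E) :
    (1 + σ) * E' ≤ (1 - t / 2) * E := by
  have h1 : (1 + σ) * (1 - t) ≤ 1 - t / 2 := by
    have := mul_le_mul_of_nonneg_right hσt (sub_nonneg.2 ht1)
    linarith [mul_nonneg ht ht]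
  calc (1 + σ) * E' ≤ (1 + σ) * ((1 - t) * E) := by gcongr
    _ = (1 + σ) * (1 - t) * E := by ring
    _ ≤ (1 - t / 2) * E := by gcongr

/-- With ζ proportional to q, the factor 1/ζ costs only one of the two powers of q. -/
theorem perturbation_le {c q lam R ρ : ℝ} (hc : 0 < c) (hq : 0 < q) (hq1 : q ≤ 1) :
    (2 + 1 / (2 * (c * q / 48))) * (lam * (4 * R * ρ * q)) ^ 2
      ≤ (2 + 24 / c) * (16 * lam ^ 2 * R ^ 2 * (ρ ^ 2 * q)) := by
  calc (2 + 1 / (2 * (c * q / 48))) * (lam * (4 * R * ρ * q)) ^ 2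
      = (2 * q + 24 / c) * (16 * lam ^ 2 * R ^ 2 * (ρ ^ 2 * q)) := by
        field_simp
        ring
    _ ≤ (2 * 1 + 24 / c) * (16 * lam ^ 2 * R ^ 2 * (ρ ^ 2 * q)) := by gcongr
    _ = _ := by ring

theorem trigaEnergy_nonneg {H : Type*} [NormedAddCommGroup H] [InnerProductSpace ℝ H]
    {f : H → ℝ} {s lam ε : ℝ} (hs : 0 ≤ s) {z : H}
    (hz : IsMinimizer (tikhonovReg f ε) z) (u d : H) : 0 ≤ trigaEnergy f s lam ε z u d :=
  add_nonneg (mul_nonneg hs (sub_nonneg.2 (hz u))) (energyQuad_nonneg _ _ _)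

/-! ### Decay rate of the energy along the iterates. -/

section Rates

variable {H : Type*} [NormedAddCommGroup H] [InnerProductSpace ℝ H] [CompleteSpace H]

theorem sqrt_mul_rpow_neg {s t : ℝ} (hs : 0 ≤ s) (ht : 0 ≤ t) (p : ℝ) :
    √(s * t ^ (-p)) = √s * t ^ (-(p / 2)) := by
  rw [Real.sqrt_mul hs, Real.sqrt_eq_rpow (t ^ (-p)), ← Real.rpow_mul ht]
  congr 2
  ring

theorem exists_trigaEnergy_le {f : H → ℝ} (hconv : ConvexOn ℝ Set.univ f)
    (hf : Differentiable ℝ f) {L : NNReal} (hL : LipschitzWith L (gradient f)) {δ s p R : ℝ}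
    (hp0 : 0 < p) (hp2 : p < 2) (hδ : 0 < δ) (hs : 0 < s) (hsL : s * (L : ℝ) < 1)
    {x y z : ℕ → H} (htriga : IsTRIGA f δ s (fun k : ℕ => (k : ℝ) ^ (-p)) x y)
    (hz : ∀ k : ℕ, 1 ≤ k → IsMinimizer (tikhonovReg f ((k : ℝ) ^ (-p))) (z k))
    (hzR : ∀ k : ℕ, 1 ≤ k → ‖z k‖ ≤ R) :
    ∃ M : ℝ, 0 ≤ M ∧ ∀ᶠ k : ℕ in atTop,
      trigaEnergy f s (δ / 2) ((k : ℝ) ^ (-p)) (z k) (x k) (x k - x (k - 1))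
        ≤ M * (k : ℝ) ^ (-(1 + p / 2)) := by
  obtain ⟨lam, rfl⟩ : ∃ lam, δ = 2 * lam := ⟨δ / 2, by ring⟩
  have hlam : 0 < lam := by linarith
  rw [mul_div_cancel_left₀ lam two_ne_zero]
  -- So sL = 1 − 4m, and s(L + ε) ≤ 1 − 2m as soon as sε ≤ 2m.
  set m := (1 - s * L) / 4 with hm
  have hm0 : 0 < m := by linarith
  obtain ⟨c, hc, hc1, hc2⟩ : ∃ c : ℝ, 0 < c ∧ c ≤ lam / 4 ∧ 12 * (lam * c) ≤ 1 := by
    refine ⟨min (lam / 4) (1 / (12 * lam)), by positivity, min_le_left _ _, ?_⟩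
    have h := min_le_right (lam / 4) (1 / (12 * lam))
    rw [le_div_iff₀ (by positivity)] at h
    linarith
  have hss : 0 < √s := Real.sqrt_pos.2 hs
  have hqlim : Tendsto (fun k : ℕ => √s * (k : ℝ) ^ (-(p / 2))) atTop (𝓝 0) := by
    simpa using (tendsto_natCast_rpow_neg (half_pos hp0)).const_mul √s
  have hsmall : ∀ {η : ℝ}, 0 < η → ∀ᶠ k : ℕ in atTop, √s * (k : ℝ) ^ (-(p / 2)) ≤ η :=
    fun hη => hqlim.eventually_le_const hη
  -- The constant is chosen to give 11ρ ≤ cq/4 with ρ = p/(2k); together with 12ζ = cq/4 for ζ =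
  -- cq/48, the drift uses at most half of the contraction cq.
  have hinv := eventually_inv_le_mul_rpow_neg (θ := p / 2) (η := c * √s / (22 * p)) (by linarith)
    (by positivity)
  refine exists_eventually_le_mul_rpow_neg (θ := p / 2) (c := c / 2 * √s)
    (C := s * p / 2 * R ^ 2 + (2 + 24 / c) * (4 * lam ^ 2 * R ^ 2 * p ^ 2) * √s)
    (by linarith) (by linarith) (by linarith) (by positivity) (by positivity) ?_
  filter_upwards [hinv, eventually_ge_atTop 1, tendsto_natCast_atTop_atTop.eventually_ge_atTop p,
    ((tendsto_natCast_rpow_neg hp0).const_mul s).eventually_le_const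
      (by linarith : s * 0 < 2 * m),
    hsmall (by positivity : 0 < 1 / 2 / lam),
    hsmall (by positivity : 0 < 1 / 4 / (4 * lam ^ 2 + 1)),
    hsmall (by positivity : 0 < m / (72 * lam)), hsmall (by positivity : 0 < m / (32 * lam ^ 3)),
    hsmall one_pos] with k hkinv hk1 hkp hkm h1q h2q h3q h4q hq1
  have hk0 : (0 : ℝ) < k := by exact_mod_cast hk1
  have hk1' : (1 : ℝ) ≤ k := by exact_mod_cast hk1
  have hε : 0 < (k : ℝ) ^ (-p) := by positivity
  have hqeq : √(s * (k : ℝ) ^ (-p)) = √s * (k : ℝ) ^ (-(p / 2)) :=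
    sqrt_mul_rpow_neg hs.le hk0.le p
  have hqeq' : √(s * ((k : ℝ) + 1) ^ (-p)) = √s * ((k : ℝ) + 1) ^ (-(p / 2)) :=
    sqrt_mul_rpow_neg hs.le (by positivity) p
  rw [le_div_iff₀ (by positivity)] at h1q h2q h3q h4q
  obtain ⟨hy, hx⟩ := htriga k hk1
  simp only at hy hx
  have hstep := trigaEnergy_step_le hconv hf hL (ε := (k : ℝ) ^ (-p)) hε hs hm0 (by linarith)
    hlam hc hc1 hc2 (by rw [hqeq]; linarith) (by rw [hqeq]; linarith) (by rw [hqeq]; linarith)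
    (by rw [hqeq]; linarith) (hz k hk1) hy hx
  have hε'le : ((k : ℝ) + 1) ^ (-p) ≤ (k : ℝ) ^ (-p) :=
    Real.rpow_le_rpow_of_nonpos hk0 (by linarith) (by linarith)
  have hb1 := rpow_neg_mul_one_sub_le hp0.le hk0
  have hb2 := rpow_neg_mul_one_sub_le (half_pos hp0).le hk0
  set ρ := p / 2 / (k : ℝ) with hρ
  have h2ρ : p / (k : ℝ) = 2 * ρ := by rw [hρ]; ring
  rw [h2ρ] at hb1
  have hρ0 : 0 ≤ ρ := by positivity
  have hρ1 : ρ ≤ 1 := by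
    rw [hρ, div_le_one hk0]
    linarith
  have hq0 : 0 < √s * (k : ℝ) ^ (-(p / 2)) := by positivity
  have hz' := hz (k + 1) (by omega)
  push_cast at hz'
  have hdrift := trigaEnergy_drift_le hconv hf hL (ε := (k : ℝ) ^ (-p))
    (ε' := ((k : ℝ) + 1) ^ (-p)) (s := s) (lam := lam) (ρ := ρ)
    (ζ := c * (√s * (k : ℝ) ^ (-(p / 2))) / 48) (R := R) (w := x (k + 1)) (d := x (k + 1) - x k)
    (by positivity) hε'le hs hlam hρ0 hρ1 (by positivity)
    (by
      rw [div_le_iff₀ hε]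
      linarith)
    (by
      rw [hqeq, hqeq']
      have := mul_le_mul_of_nonneg_left hb2 hss.le
      linarith)
    (hz k hk1) hz' (hzR k hk1) (hzR (k + 1) (by omega))
  rw [hqeq] at hstep hdrift
  have hE0 := trigaEnergy_nonneg (lam := lam) hs.le (hz k hk1) (x k) (x k - x (k - 1))
  push_cast
  generalize trigaEnergy f s lam ((k : ℝ) ^ (-p)) (z k) (x k) (x k - x (k - 1)) = E at *
  generalize trigaEnergy f s lam ((k : ℝ) ^ (-p)) (z k) (x (k + 1)) (x (k + 1) - x k) = E₁ at *
  generalize trigaEnergy f s lam (((k : ℝ) + 1) ^ (-p)) (z (k + 1)) (x (k + 1))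
    (x (k + 1) - x k) = E₂ at *
  have hpow : (k : ℝ) ^ (-p) * ρ = p / 2 * (k : ℝ) ^ (-(1 + p / 2 + p / 2)) := by
    have e : -(1 + p / 2 + p / 2) = -p - 1 := by ring
    rw [e, Real.rpow_sub_one hk0.ne', hρ]
    ring
  -- Here p < 2 gives −p/2 − 2 ≤ −1 − p.
  have hpow2 : ρ ^ 2 * (k : ℝ) ^ (-(p / 2)) ≤ p ^ 2 / 4 * (k : ℝ) ^ (-(1 + p / 2 + p / 2)) := by
    have e : ρ ^ 2 * (k : ℝ) ^ (-(p / 2)) = p ^ 2 / 4 * (k : ℝ) ^ (-(p / 2) - 2) := by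
      rw [Real.rpow_sub hk0, Real.rpow_two, hρ]
      field_simp
      norm_num
    rw [e]
    refine mul_le_mul_of_nonneg_left (Real.rpow_le_rpow_of_exponent_le hk1' ?_) (by positivity)
    linarith
  set P := (k : ℝ) ^ (-(1 + p / 2 + p / 2)) with hP
  set q := √s * (k : ℝ) ^ (-(p / 2)) with hq
  have h11 : 11 * ρ ≤ c * q / 4 := by
    have i := mul_le_mul_of_nonneg_left hkinv (by positivity : 0 ≤ 11 * (p / 2))
    have e1 : 11 * (p / 2) * (1 / (k : ℝ)) = 11 * ρ := by rw [hρ]; ring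
    have e2 : 11 * (p / 2) * (c * √s / (22 * p) * (k : ℝ) ^ (-(p / 2))) = c * q / 4 := by
      rw [hq]
      field_simp
      norm_num
    rwa [e1, e2] at i
  have hfirst : (1 + 11 * ρ + 12 * (c * q / 48)) * E₁ ≤ (1 - c / 2 * q) * E := by
    have i : c * q ≤ lam / 4 * q := by gcongr
    have := mul_le_one_add_mul_of_contraction (t := c * q) (σ := 11 * ρ + 12 * (c * q / 48))
      (by positivity) (by linarith) (by positivity) (by linarith) hE0 hstep
    linarith
  have hsecond : s * ((k : ℝ) ^ (-p) - ((k : ℝ) + 1) ^ (-p)) / 2 * R ^ 2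
      ≤ s * p / 2 * R ^ 2 * P := by
    have i : (k : ℝ) ^ (-p) - ((k : ℝ) + 1) ^ (-p) ≤ p * P := by linarith
    calc s * ((k : ℝ) ^ (-p) - ((k : ℝ) + 1) ^ (-p)) / 2 * R ^ 2 ≤ s * (p * P) / 2 * R ^ 2 := by
          gcongr
      _ = _ := by ring
  have hthird : (2 + 1 / (2 * (c * q / 48))) * (lam * (4 * R * ρ * q)) ^ 2
      ≤ (2 + 24 / c) * (4 * lam ^ 2 * R ^ 2 * p ^ 2) * √s * P := by
    refine (perturbation_le hc hq0 hq1).trans ?_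
    have e : ρ ^ 2 * q = √s * (ρ ^ 2 * (k : ℝ) ^ (-(p / 2))) := by rw [hq]; ring
    calc (2 + 24 / c) * (16 * lam ^ 2 * R ^ 2 * (ρ ^ 2 * q))
        ≤ (2 + 24 / c) * (16 * lam ^ 2 * R ^ 2 * (√s * (p ^ 2 / 4 * P))) := by
          rw [e]
          gcongr
      _ = _ := by ring
  linarith

end Rates

/-! ### Reading off the rates. -/

theorem theorem3p1 {H : Type*} [NormedAddCommGroup H] [InnerProductSpace ℝ H] [CompleteSpace H]
    (f : H → ℝ) (L : NNReal) (δ s p : ℝ) (x y : ℕ → H)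
    (hp0 : 0 < p) (hp2 : p < 2) (hδ : 0 < δ) (hs : 0 < s) (hsL : s * (L : ℝ) < 1)
    (hconv : ConvexOn ℝ Set.univ f) (hdiff : Differentiable ℝ f)
    (hlip : LipschitzWith L (gradient f))
    (hargmin : ∃ z : H, IsMinimizer f z)
    (htriga : IsTRIGA f δ s (fun k : ℕ => 1 / (k : ℝ) ^ p) x y) :
    ∃ (xε : ℕ → H) (xstar : H),
      (∀ k : ℕ, 1 ≤ k → IsUniqueMinimizer (tikhonovReg f (1 / (k : ℝ) ^ p)) (xε k)) ∧
      IsMinNormMinimizer f xstar ∧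
      (fun k : ℕ => f (x k) - ⨅ z : H, f z) =O[atTop] (fun k : ℕ => 1 / (k : ℝ) ^ p) ∧
      (fun k : ℕ => ‖x k - xε k‖ ^ 2) =O[atTop] (fun k : ℕ => 1 / (k : ℝ) ^ ((2 - p) / 2)) ∧
      Tendsto x atTop (𝓝 xstar) ∧
      (fun k : ℕ => ‖x k - x (k - 1)‖) =O[atTop] (fun k : ℕ => 1 / (k : ℝ) ^ ((2 + p) / 4)) := by
  have hpow : ∀ (r : ℝ) (k : ℕ), 1 / (k : ℝ) ^ r = (k : ℝ) ^ (-r) := fun r k => by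
    rw [Real.rpow_neg (Nat.cast_nonneg k), one_div]
  simp only [hpow] at htriga ⊢
  have hεpos : ∀ k : ℕ, 1 ≤ k → 0 < (k : ℝ) ^ (-p) := fun k hk => by
    have : (0 : ℝ) < k := by exact_mod_cast hk
    positivity
  have hex : ∀ k : ℕ, ∃ z, 1 ≤ k → IsMinimizer (tikhonovReg f ((k : ℝ) ^ (-p))) z := fun k => by
    by_cases hk : 1 ≤ k
    · obtain ⟨z, hz⟩ := exists_isMinimizer_tikhonovReg hconv hdiff.continuous hargmin (hεpos k hk)
      exact ⟨z, fun _ => hz⟩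
    · exact ⟨0, fun h => absurd h hk⟩
  choose xε hxε using hex
  -- Shift by one: at k = 0 the real power 0^(−p) is 0, so positivity of the parameter fails there.
  obtain ⟨xstar, hstar, hlim⟩ := exists_isMinNormMinimizer_tendsto hconv hdiff hlip hargmin
    (ε := fun n : ℕ => ((n + 1 : ℕ) : ℝ) ^ (-p)) (z := fun n => xε (n + 1))
    (fun n => hεpos (n + 1) (by omega))
    (fun m n hmn => Real.rpow_le_rpow_of_nonpos (by positivity) (by exact_mod_cast by omega)
      (by linarith))
    ((tendsto_add_atTop_iff_nat 1).2 (tendsto_natCast_rpow_neg hp0))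
    (fun n => hxε (n + 1) (by omega))
  replace hlim : Tendsto xε atTop (𝓝 xstar) := (tendsto_add_atTop_iff_nat 1).1 hlim
  have hmin : ⨅ z, f z = f xstar :=
    le_antisymm (ciInf_le ⟨f xstar, by rintro _ ⟨w, rfl⟩; exact hstar.1 w⟩ _)
      (haveI : Nonempty H := ⟨xstar⟩; le_ciInf hstar.1)
  have hxεR : ∀ k : ℕ, 1 ≤ k → ‖xε k‖ ≤ ‖xstar‖ := fun k hk =>
    (hxε k hk).norm_le_of_tikhonovReg (hεpos k hk) hstar.1
  obtain ⟨M, hM, hE⟩ := exists_trigaEnergy_le hconv hdiff hlip hp0 hp2 hδ hs hsL htriga hxε hxεR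
  have hvalue : (fun k : ℕ => f (x k) - ⨅ z : H, f z) =O[atTop] (fun k : ℕ => (k : ℝ) ^ (-p)) := by
    refine IsBigO.of_bound (M / s + ‖xstar‖ ^ 2 / 2) ?_
    filter_upwards [hE, eventually_ge_atTop 1] with k hk hk1
    have hk1' : (1 : ℝ) ≤ k := by exact_mod_cast hk1
    have hε := hεpos k hk1
    rw [hmin, Real.norm_eq_abs, Real.norm_eq_abs, abs_of_nonneg (sub_nonneg.2 (hstar.1 _)),
      abs_of_pos hε]
    have i1 := energyQuad_nonneg (δ / 2) (x k - x (k - 1)) (√(s * (k : ℝ) ^ (-p)) • (x k - xε k))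
    have i2 : (k : ℝ) ^ (-(1 + p / 2)) ≤ (k : ℝ) ^ (-p) := by
      refine Real.rpow_le_rpow_of_exponent_le hk1' ?_
      linarith
    have i3 : s * (tikhonovReg f ((k : ℝ) ^ (-p)) (x k) - tikhonovReg f ((k : ℝ) ^ (-p)) (xε k))
        ≤ M * (k : ℝ) ^ (-p) := by
      have := mul_le_mul_of_nonneg_left i2 hM
      unfold trigaEnergy at hk
      linarith
    rw [mul_comm, ← le_div_iff₀ hs] at i3
    -- Comparing the regularized minimum with the value at x* costs only (ε_k/2)‖x*‖², the term that
    -- limits the rate to k^{−p}.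
    have i4 := hxε k hk1 xstar
    have i5 : 0 ≤ (k : ℝ) ^ (-p) / 2 * ‖x k‖ ^ 2 := by positivity
    have i6 : (M / s + ‖xstar‖ ^ 2 / 2) * (k : ℝ) ^ (-p)
        = M * (k : ℝ) ^ (-p) / s + (k : ℝ) ^ (-p) / 2 * ‖xstar‖ ^ 2 := by ring
    rw [i6]
    unfold tikhonovReg at i3 i4
    linarith
  have hdist : (fun k : ℕ => ‖x k - xε k‖ ^ 2) =O[atTop]
      (fun k : ℕ => (k : ℝ) ^ (-((2 - p) / 2))) := by
    refine IsBigO.of_bound (2 * M / s) ?_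
    filter_upwards [hE, eventually_ge_atTop 1] with k hk hk1
    have hk0 : (0 : ℝ) < k := by exact_mod_cast hk1
    have hε := hεpos k hk1
    rw [Real.norm_eq_abs, Real.norm_eq_abs, abs_of_nonneg (by positivity),
      abs_of_nonneg (by positivity)]
    have i1 := energyQuad_nonneg (δ / 2) (x k - x (k - 1)) (√(s * (k : ℝ) ^ (-p)) • (x k - xε k))
    have i2 := (hxε k hk1).add_sq_le_tikhonovReg hconv hdiff hlip hε (x k)
    have i3 : s * ((k : ℝ) ^ (-p) / 2 * ‖x k - xε k‖ ^ 2) ≤ M * (k : ℝ) ^ (-(1 + p / 2)) := by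
      refine le_trans ?_ hk
      unfold trigaEnergy
      have := mul_le_mul_of_nonneg_left i2 hs.le
      linarith
    have i4 : (k : ℝ) ^ (-(1 + p / 2)) = (k : ℝ) ^ (-p) * (k : ℝ) ^ (-((2 - p) / 2)) := by
      rw [← Real.rpow_add hk0]
      congr 1
      ring
    rw [i4] at i3
    have i5 : s * ‖x k - xε k‖ ^ 2 ≤ 2 * M * (k : ℝ) ^ (-((2 - p) / 2)) := by
      refine le_of_mul_le_mul_left ?_ hε
      linarith
    rw [div_mul_eq_mul_div, le_div_iff₀ hs]
    linarith
  refine ⟨xε, xstar, fun k hk => (hxε k hk).isUniqueMinimizer_tikhonovReg hconv hdiff hlip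
    (hεpos k hk), hstar, hvalue, hdist, ?_, ?_⟩
  · have i1 : Tendsto (fun k => ‖x k - xε k‖ ^ 2) atTop (𝓝 0) :=
      hdist.trans_tendsto (tendsto_natCast_rpow_neg (by linarith))
    have i2 : Tendsto (fun k => ‖x k - xε k‖) atTop (𝓝 0) := by
      simpa using i1.sqrt
    simpa using (tendsto_zero_iff_norm_tendsto_zero.2 i2).add hlim
  · refine IsBigO.of_bound (√(4 * M)) ?_
    filter_upwards [hE, eventually_ge_atTop 1] with k hk hk1
    have hk0 : (0 : ℝ) < k := by exact_mod_cast hk1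
    rw [norm_norm, Real.norm_eq_abs, abs_of_nonneg (by positivity)]
    have i1 := sq_norm_le_energyQuad (δ / 2) (x k - x (k - 1))
      (√(s * (k : ℝ) ^ (-p)) • (x k - xε k))
    have i2 := mul_nonneg hs.le (sub_nonneg.2 (hxε k hk1 (x k)))
    have i3 : ‖x k - x (k - 1)‖ ^ 2 ≤ 4 * M * (k : ℝ) ^ (-(1 + p / 2)) := by
      unfold trigaEnergy at hk
      linarith
    have i4 : (k : ℝ) ^ (-(1 + p / 2)) = ((k : ℝ) ^ (-((2 + p) / 4))) ^ 2 := by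
      rw [← Real.rpow_natCast, ← Real.rpow_mul hk0.le]
      congr 1
      push_cast
      ring
    rw [i4] at i3
    calc ‖x k - x (k - 1)‖ ≤ √(4 * M * ((k : ℝ) ^ (-((2 + p) / 4))) ^ 2) := Real.le_sqrt_of_sq_le i3
      _ = √(4 * M) * (k : ℝ) ^ (-((2 + p) / 4)) := by
          rw [Real.sqrt_mul (by positivity), Real.sqrt_sq (by positivity)]
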